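/- Let $p$ be a prime, let $R$ be a (Noetherian) regular local ring of characteristic $p$, and let $S$ be an $R$-algebra that is a reduced local ring, meaning a reduced ring with a unique maximal ideal ($S$ is not required to be Noetherian). For a reduced ring $A$ of characteristic $p$ let $A_\infty$ denote its (minimal) perfect closure, and for $n\ge 0$ let $A_n=A^{1/p^n}=\{x\in A_\infty : x^{p^n}\in A\}$, so that $A_\infty=\bigcup_n A_n$; the map $R\to S$ induces ring homomorphisms $R_\infty\to S_\infty$ and $R_n\to S_n$. Assume that 1. $R\to S$ is generically étale with nonzero generic fibre, i.e. $S\otimes_R\mathrm{Frac}(R)$ is étale over $\mathrm{Frac}(R)$ and nonzero (equivalently, it is a nonempty finite product of finite separable field extensions of $\mathrm{Frac}(R)$); 2. $S_\infty$ is module-finite over $R_\infty$. Then there is an $N$ such that $R_n\to S_n$ is étale for all $n\ge N$. -/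

import Mathlib

open scoped TensorProduct

/-- The ring homomorphism `R_∞ → S_∞` induced by `R → S` on (minimal) perfect closures.
The perfect closure `A_∞` of a ring `A` of characteristic `p` is Mathlib's `PerfectClosure A p`,
the colimit of `A → A → A → ⋯` along the Frobenius endomorphism; when `A` is reduced it contains
`A` and it is the union of the rings `A ^ (1 / p ^ n)`. -/
noncomputable def perfectClosureMap (p : ℕ) [Fact p.Prime] (R S : Type*)
    [CommRing R] [CharP R p] [CommRing S] [CharP S p] [Algebra R S] :
    PerfectClosure R p →+* PerfectClosure S p :=
  PerfectClosure.lift R p (PerfectClosure S p)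
    ((PerfectClosure.of S p).comp (algebraMap R S))

/-- The induced map sends the image of `r : R` to the image of `algebraMap R S r`. -/
theorem perfectClosureMap_of (p : ℕ) [Fact p.Prime] (R S : Type*)
    [CommRing R] [CharP R p] [CommRing S] [CharP S p] [Algebra R S] (r : R) :
    perfectClosureMap p R S (PerfectClosure.of R p r) =
      PerfectClosure.of S p (algebraMap R S r) :=
  RingHom.congr_fun ((PerfectClosure.lift R p (PerfectClosure S p)).symm_apply_apply
    ((PerfectClosure.of S p).comp (algebraMap R S))) r

/-- `A_n = A ^ (1 / p ^ n)`: the subring of `A_∞` of all `x` such that `x ^ (p ^ n)` lies in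
(the image of) `A`. -/
def rootRing (p : ℕ) [Fact p.Prime] (A : Type*) [CommRing A] [CharP A p] (n : ℕ) :
    Subring (PerfectClosure A p) :=
  (PerfectClosure.of A p).range.comap (iterateFrobenius (PerfectClosure A p) p n)

theorem mem_rootRing {p : ℕ} [Fact p.Prime] {A : Type*} [CommRing A] [CharP A p] {n : ℕ}
    {x : PerfectClosure A p} :
    x ∈ rootRing p A n ↔ ∃ a : A, PerfectClosure.of A p a = x ^ p ^ n := by
  simp [rootRing, iterateFrobenius_def]

theorem perfectClosureMap_mem_rootRing (p : ℕ) [Fact p.Prime] (R S : Type*)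
    [CommRing R] [CharP R p] [CommRing S] [CharP S p] [Algebra R S] (n : ℕ)
    (x : PerfectClosure R p) (hx : x ∈ rootRing p R n) :
    perfectClosureMap p R S x ∈ rootRing p S n := by
  obtain ⟨a, ha⟩ := mem_rootRing.1 hx
  exact mem_rootRing.2 ⟨algebraMap R S a, by rw [← map_pow, ← ha, perfectClosureMap_of]⟩

/-- The ring homomorphism `R_n → S_n` obtained by restricting `R_∞ → S_∞`. -/
noncomputable def rootRingMap (p : ℕ) [Fact p.Prime] (R S : Type*)
    [CommRing R] [CharP R p] [CommRing S] [CharP S p] [Algebra R S] (n : ℕ) :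
    rootRing p R n →+* rootRing p S n :=
  (perfectClosureMap p R S).restrict (rootRing p R n) (rootRing p S n)
    (perfectClosureMap_mem_rootRing p R S n)

/-- `R → S` is generically étale: the generic fibre `Frac(R) ⊗_R S` is étale over `Frac(R)`.
(Used for a domain `R`, where `FractionRing R` is the field of fractions.) -/
def GenericallyEtale (R S : Type*) [CommRing R] [CommRing S] [Algebra R S] : Prop :=
  Algebra.Etale (FractionRing R) (FractionRing R ⊗[R] S)

/-! Already R → S is étale, so N = 0 works: taking p^n-th roots identifies R_n → S_n with R → S.

Clearing roots, finiteness of S_∞ gives s_1, …, s_k in S such that for all x in S and all n, some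
x^(p^m) is an R-combination of the s_i^(p^(m+n)). Map S to a residue field L of the generic fibre,
finite separable over K = Frac R. Frobenius on R is flat (Kunz), and p-th powers of a K-basis of L
stay independent, so linear relations among p-th powers in L descend to relations among the elements
themselves. Hence the image A of S is spanned over R by the s_i^(p^n), for every n.

For n = 0 this makes A finite; for n = 1 it is spanned by p-th powers, whose differentials vanish,
so A is unramified. The ideal J of coefficients of relations among minimal generators satisfies J ⊆
mJ, so A is free, hence étale. Finally S → A is injective: by the same power relations and Nakayama
in S, its kernel consists of nilpotents. -/

/-! ### Flatness from a quotient by a regular element -/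

/-- Tensoring (I : a) → I × R → I + (a) → 0 with M is right exact, so an element of I ⊗ M dying in M
comes from (I : a) ⊗ M, where its R-component forces it to vanish. Over a Noetherian ring, flatness
thus needs testing on primes only. -/
theorem Ideal.isOka_injective_rTensor_subtype (R M : Type*) [CommRing R] [AddCommGroup M]
    [Module R M] :
    Ideal.IsOka fun I : Ideal R ↦ Function.Injective (I.subtype.rTensor M) where
  top := (LinearEquiv.rTensor M (Submodule.topEquiv (R := R) (M := R))).injective
  oka := by
    intro I a h₁ h₂
    set J := I.colon (Ideal.span {a}) with hJ
    have hmem (j : J) : (j : R) * a ∈ I := Ideal.mem_colon_span_singleton.1 j.2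
    let f : J →ₗ[R] I × R := LinearMap.prod
      (LinearMap.codRestrict I (LinearMap.mulRight R a ∘ₗ J.subtype) hmem) (-J.subtype)
    let g : I × R →ₗ[R] (I ⊔ Ideal.span {a} : Ideal R) :=
      LinearMap.coprod (Submodule.inclusion le_sup_left)
        (LinearMap.toSpanSingleton R _ ⟨a, Ideal.mem_sup_right (Ideal.mem_span_singleton_self a)⟩)
    have hfg : Function.Exact f g := by
      rintro ⟨i, r⟩
      have hg : g (i, r) = 0 ↔ (i : R) + r * a = 0 := by
        rw [Subtype.ext_iff]; simp [g]
      rw [hg]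
      constructor
      · intro h
        refine ⟨⟨-r, Ideal.mem_colon_span_singleton.2 ?_⟩, ?_⟩
        · have : -r * a = i := by rw [neg_mul]; exact neg_eq_of_add_eq_zero_left h
          exact this ▸ i.2
        · ext
          · change -r * a = i
            rw [neg_mul]; exact neg_eq_of_add_eq_zero_left h
          · simp [f]
      · rintro ⟨j, hj⟩
        obtain ⟨h3, h4⟩ := Prod.ext_iff.1 hj
        have h3 : (j : R) * a = i := congrArg Subtype.val h3
        have h4 : -(j : R) = r := h4
        rw [← h3, ← h4]; ring
    have hg : Function.Surjective g := by
      rintro ⟨y, hy⟩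
      obtain ⟨i, hi, z, hz, rfl⟩ := Submodule.mem_sup.1 hy
      obtain ⟨r, rfl⟩ := Ideal.mem_span_singleton'.1 hz
      exact ⟨(⟨i, hi⟩, r), by ext; simp [g]⟩
    have hex := rTensor_exact M hfg hg
    rw [← LinearMap.ker_eq_bot, LinearMap.ker_eq_bot']
    intro z hz
    have e₁ : (I ⊔ Ideal.span {a}).subtype ∘ₗ g ∘ₗ LinearMap.inl R I R = I.subtype := by
      ext; simp [g]
    have h5 : g.rTensor M ((LinearMap.inl R I R).rTensor M z) = 0 := by
      apply h₁
      rw [map_zero, ← LinearMap.comp_apply, ← LinearMap.comp_apply, ← LinearMap.rTensor_comp,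
        ← LinearMap.rTensor_comp, LinearMap.comp_assoc, e₁, hz]
    obtain ⟨y, hy⟩ := (hex _).1 h5
    have e₂ : LinearMap.snd R I R ∘ₗ LinearMap.inl R I R = 0 := by ext; simp
    have e₃ : LinearMap.fst R I R ∘ₗ LinearMap.inl R I R = LinearMap.id := by ext; simp
    have e₄ : LinearMap.snd R I R ∘ₗ f = -J.subtype := by ext; simp [f]
    have hy0 : y = 0 := by
      apply h₂
      have := congrArg ((LinearMap.snd R I R).rTensor M) hy
      rw [← LinearMap.comp_apply, ← LinearMap.comp_apply, ← LinearMap.rTensor_comp,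
        ← LinearMap.rTensor_comp, e₂, e₄, LinearMap.rTensor_zero, LinearMap.rTensor_neg] at this
      simpa using this
    have := congrArg ((LinearMap.fst R I R).rTensor M) hy
    rw [hy0, map_zero, map_zero, ← LinearMap.comp_apply, ← LinearMap.rTensor_comp, e₃] at this
    simpa using this.symm

/-- A local criterion of flatness; `hflat` is the equational criterion for R/(x) → S/(φ x). -/
theorem RingHom.Flat.of_quotient_span_singleton {R S : Type*} [CommRing R] [CommRing S]
    [IsNoetherianRing R] [IsNoetherianRing S] (φ : R →+* S) (x : R)
    (hjac : φ x ∈ Ideal.jacobson (⊥ : Ideal S)) (hreg : ∀ y, φ x * y = 0 → y = 0)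
    (hflat : ∀ {l : ℕ} (f : Fin l → R) (w : Fin l → S), ∑ i, φ (f i) * w i ∈ Ideal.span {φ x} →
      ∃ (k : ℕ) (a : Fin l → Fin k → R) (y : Fin k → S),
        (∀ i, w i - ∑ j, φ (a i j) * y j ∈ Ideal.span {φ x}) ∧
          ∀ j, ∑ i, f i * a i j ∈ Ideal.span {x}) : φ.Flat := by
  algebraize [φ]
  change ∀ y, algebraMap R S x * y = 0 → y = 0 at hreg
  change algebraMap R S x ∈ _ at hjac
  rw [RingHom.Flat]
  rw [Module.Flat.iff_rTensor_injective']
  refine (Ideal.isOka_injective_rTensor_subtype R S).forall_of_forall_prime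
    (fun I hI ↦ ?_) fun P hP ↦ ?_
  · obtain ⟨J, hJ, hm⟩ := set_has_maximal_iff_noetherian.2 (inferInstanceAs (IsNoetherian R R))
      {I | ¬ Function.Injective (I.subtype.rTensor S)} ⟨I, hI⟩
    exact ⟨J, hJ, fun K hK hle ↦ not_lt_iff_le_imp_ge.1 (hm K hK) hle⟩
  obtain ⟨n, b, hb⟩ := Submodule.fg_iff_exists_fin_generating_family.1
    (IsNoetherian.noetherian (⊤ : Submodule R P))
  have hbspan (c : P) : ∃ e : Fin n → R, c = ∑ i, e i • b i := by
    have : c ∈ Submodule.span R (Set.range b) := hb ▸ Submodule.mem_top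
    obtain ⟨e, he⟩ := (Submodule.mem_span_range_iff_exists_fun R).1 this
    exact ⟨e, he.symm⟩
  have hrep (z : P ⊗[R] S) : ∃ w : Fin n → S, z = ∑ i, b i ⊗ₜ[R] w i := by
    induction z with
    | zero => exact ⟨0, by simp⟩
    | tmul c s =>
      obtain ⟨e, rfl⟩ := hbspan c
      exact ⟨fun i ↦ e i • s, by simp [TensorProduct.sum_tmul, TensorProduct.smul_tmul]⟩
    | add z₁ z₂ h₁ h₂ =>
      obtain ⟨w₁, rfl⟩ := h₁
      obtain ⟨w₂, rfl⟩ := h₂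
      exact ⟨w₁ + w₂, by simp [TensorProduct.tmul_add, Finset.sum_add_distrib]⟩
  rw [← LinearMap.ker_eq_bot, LinearMap.ker_eq_bot']
  intro z hz
  obtain ⟨w, rfl⟩ := hrep z
  have hw : ∑ i, algebraMap R S (b i) * w i = 0 := by
    simpa [Algebra.smul_def] using congrArg (TensorProduct.lid R S) hz
  -- Solve the relation modulo x; the errors `u` and `c` satisfy a new relation once x, a
  -- nonzerodivisor on S, is cancelled.
  have key (w : Fin n → S) (hw : ∑ i, algebraMap R S (b i) * w i = 0) :
      ∃ (k : ℕ) (a : Fin n → Fin k → R) (y : Fin k → S) (u : Fin n → S) (c : Fin k → R),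
        (∀ i, w i = ∑ j, a i j • y j + x • u i) ∧ (∀ j, ∑ i, (b i : R) * a i j = c j * x) ∧
          ∑ j, c j • y j + ∑ i, (b i : R) • u i = 0 := by
    obtain ⟨k, a, y, h₁, h₂⟩ := hflat (fun i ↦ (b i : R)) w
      (by change ∑ i, algebraMap R S (b i) * w i ∈ _; simp [hw])
    choose u hu using fun i ↦ Ideal.mem_span_singleton'.1 (h₁ i)
    choose c hc using fun j ↦ Ideal.mem_span_singleton'.1 (h₂ j)
    change ∀ i, u i * algebraMap R S x = w i - ∑ j, algebraMap R S (a i j) * y j at hu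
    have hwi (i) : w i = ∑ j, a i j • y j + x • u i := by
      simp only [Algebra.smul_def]; linear_combination -hu i
    refine ⟨k, a, y, u, c, hwi, fun j ↦ (hc j).symm, hreg _ ?_⟩
    rw [← hw, mul_add, Finset.mul_sum, Finset.mul_sum]
    simp only [hwi, mul_add, Finset.sum_add_distrib, Finset.mul_sum]
    rw [Finset.sum_comm (γ := Fin n)]
    congr 1
    · refine Finset.sum_congr rfl fun j _ ↦ ?_
      simp only [Algebra.smul_def, ← mul_assoc, ← Finset.sum_mul, ← map_mul, ← map_sum]
      rw [← hc j, mul_comm x]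
    · refine Finset.sum_congr rfl fun i _ ↦ ?_
      simp only [Algebra.smul_def]; ring
  by_cases hxP : x ∈ P
  -- For x in P the whole tensor collapses to x ⊗ 0.
  · obtain ⟨k, a, y, u, c, h₁, h₂, h₃⟩ := key w hw
    have : ∑ i, b i ⊗ₜ[R] w i =
        (⟨x, hxP⟩ : P) ⊗ₜ[R] (∑ j, c j • y j + ∑ i, (b i : R) • u i) := by
      simp only [h₁, TensorProduct.tmul_add, Finset.sum_add_distrib, TensorProduct.tmul_sum,
        ← TensorProduct.smul_tmul]
      rw [Finset.sum_comm]
      simp only [← TensorProduct.sum_tmul]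
      congr 1
      · refine Finset.sum_congr rfl fun j _ ↦ ?_
        congr 1
        ext
        simpa [mul_comm] using h₂ j
      · refine Finset.sum_congr rfl fun i _ ↦ ?_
        congr 1
        ext
        simp [mul_comm]
    rw [this, h₃, TensorProduct.tmul_zero]
  · let ψ : (Fin n → S) →ₗ[S] S := Fintype.linearCombination S fun i ↦ algebraMap R S (b i)
    have hψ (w) : ψ w = ∑ i, algebraMap R S (b i) * w i := by
      simp [ψ, Fintype.linearCombination_apply, mul_comm]
    let Q : Submodule S (Fin n → S) := Submodule.span S
      {v | ∃ r : Fin n → R, ∑ i, (b i : R) * r i = 0 ∧ v = fun i ↦ algebraMap R S (r i)}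
    -- For x outside P, primality puts each `c j` in P, so `a i j - x * e j i` is a true syzygy over
    -- R. Hence ker ψ ≤ Q + x ker ψ, and Nakayama applies.
    have hle : LinearMap.ker ψ ≤ Q := by
      refine Submodule.le_of_le_smul_of_le_jacobson_bot (I := Ideal.span {algebraMap R S x})
        (IsNoetherian.noetherian _) ((Ideal.span_singleton_le_iff_mem _).2 hjac) fun w hw ↦ ?_
      rw [LinearMap.mem_ker, hψ] at hw
      obtain ⟨k, a, y, u, c, h₁, h₂, h₃⟩ := key w hw
      have hc (j) : c j ∈ P := (hP.mem_or_mem (x := c j) (y := x)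
        (h₂ j ▸ P.sum_mem fun i _ ↦ P.mul_mem_right _ (b i).2)).resolve_right hxP
      choose e he using fun j ↦ hbspan ⟨c j, hc j⟩
      replace he (j) : c j = ∑ i, e j i * b i := by simpa using congrArg Subtype.val (he j)
      have hdecomp : w = ∑ j, y j • (fun i ↦ algebraMap R S (a i j - x * e j i)) +
          algebraMap R S x • (fun i ↦ ∑ j, e j i • y j + u i) := by
        ext i
        simp only [Pi.add_apply, Finset.sum_apply, Pi.smul_apply, smul_eq_mul]
        simp only [h₁ i, Algebra.smul_def, mul_add, Finset.mul_sum, map_sub, map_mul, mul_sub,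
          Finset.sum_sub_distrib]
        have : ∀ j, y j * (algebraMap R S x * algebraMap R S (e j i)) =
          algebraMap R S x * (algebraMap R S (e j i) * y j) := fun j ↦ by ring
        simp only [this, mul_comm (y _)]
        ring
      rw [hdecomp]
      refine Submodule.add_mem_sup (Submodule.sum_mem _ fun j _ ↦ Submodule.smul_mem _ _
        (Submodule.subset_span ⟨_, ?_, rfl⟩)) (Submodule.smul_mem_smul
          (Ideal.mem_span_singleton_self _) ?_)
      · simp only [mul_sub, Finset.sum_sub_distrib, h₂ j, he j, Finset.sum_mul]
        rw [sub_eq_zero]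
        exact Finset.sum_congr rfl fun i _ ↦ by ring
      · rw [LinearMap.mem_ker, hψ, ← h₃]
        simp only [mul_add, Finset.sum_add_distrib, Finset.mul_sum, Algebra.smul_def]
        rw [Finset.sum_comm]
        congr 1
        refine Finset.sum_congr rfl fun j _ ↦ ?_
        rw [he j, map_sum, Finset.sum_mul]
        exact Finset.sum_congr rfl fun i _ ↦ by rw [map_mul]; ring
    have hwQ : w ∈ Q := hle (by rw [LinearMap.mem_ker, hψ, hw])
    clear hw hz
    induction hwQ using Submodule.span_induction with
    | mem v hv =>
      obtain ⟨r, hr, rfl⟩ := hv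
      simp only [Algebra.algebraMap_eq_smul_one, ← TensorProduct.smul_tmul,
        ← TensorProduct.sum_tmul]
      rw [show ∑ i, r i • b i = 0 by ext; simpa [mul_comm] using hr, TensorProduct.zero_tmul]
    | zero => simp
    | add v₁ v₂ _ _ h₁ h₂ =>
      simp [TensorProduct.tmul_add, Finset.sum_add_distrib, h₁, h₂]
    | smul s v _ h =>
      simpa using congrArg (LinearMap.lTensor P (LinearMap.mulLeft R s)) h

/-! ### Powers of regular sequences -/

/-- A list of ring elements is weakly regular modulo the ideal `I` if each entry is a
nonzerodivisor modulo `I` and the preceding entries. -/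
def Ideal.IsWeaklyRegularMod {R : Type*} [CommRing R] (I : Ideal R) : List R → Prop
  | [] => True
  | x :: xs => (∀ y, x * y ∈ I → y ∈ I) ∧ (I ⊔ Ideal.span {x}).IsWeaklyRegularMod xs

namespace Ideal.IsWeaklyRegularMod

theorem map_iff {R S : Type*} [CommRing R] [CommRing S] {f : R →+* S}
    (hf : Function.Surjective f) {rs : List R} {I : Ideal S} :
    I.IsWeaklyRegularMod (rs.map f) ↔ (I.comap f).IsWeaklyRegularMod rs := by
  induction rs generalizing I with
  | nil => simp [IsWeaklyRegularMod]
  | cons x xs ih =>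
    have : (I ⊔ span {f x}).comap f = I.comap f ⊔ span {x} := by
      have h1 : I ⊔ span {f x} = (I.comap f ⊔ span {x}).map f := by
        rw [Ideal.map_sup, Ideal.map_comap_of_surjective f hf, Ideal.map_span, Set.image_singleton]
      rw [h1, Ideal.comap_map_of_surjective f hf, sup_eq_left]
      exact (Ideal.comap_mono bot_le).trans le_sup_left
    simp only [List.map_cons, IsWeaklyRegularMod, ih, this, hf.forall, Ideal.mem_comap, map_mul]

variable {R : Type*} [CommRing R]

/-- Weak regularity of a list passes to extensions of cyclic modules:
`0 → R ⧸ B → R ⧸ C → R ⧸ (C ⊔ (t)) → 0` with `B = (C : t)`. -/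
theorem of_colon {rs : List R} {B C : Ideal R} {t : R}
    (hB : ∀ y, t * y ∈ C ↔ y ∈ B) (h₁ : (C ⊔ span {t}).IsWeaklyRegularMod rs)
    (h₂ : B.IsWeaklyRegularMod rs) : C.IsWeaklyRegularMod rs := by
  induction rs generalizing B C with
  | nil => trivial
  | cons r rs ih =>
    -- As r is regular modulo C + (t), the colon (C + (r) : t) is B + (r), so the exact sequence
    -- survives reduction modulo r.
    refine ⟨fun y hy ↦ ?_, ih (B := B ⊔ span {r}) (fun y ↦ ⟨fun hy ↦ ?_, fun hy ↦ ?_⟩) ?_ h₂.2⟩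
    · obtain ⟨c, hc, z, hz, rfl⟩ := Submodule.mem_sup.1 (h₁.1 y (mem_sup_left hy))
      obtain ⟨z, rfl⟩ := mem_span_singleton'.1 hz
      have : t * (r * z) ∈ C := by
        have := C.sub_mem hy (C.mul_mem_left r hc)
        convert this using 1; ring
      have := (hB z).2 (h₂.1 z ((hB _).1 this))
      exact C.add_mem hc (by rwa [mul_comm])
    · obtain ⟨c, hc, u, hu, h⟩ := Submodule.mem_sup.1 hy
      obtain ⟨u, rfl⟩ := mem_span_singleton'.1 hu
      have : r * u ∈ C ⊔ span {t} := by
        have : r * u = -c + y * t := by linear_combination h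
        rw [this]
        exact add_mem (mem_sup_left (C.neg_mem hc))
          (mem_sup_right (mul_mem_left _ _ (mem_span_singleton_self t)))
      obtain ⟨c', hc', z, hz, rfl⟩ := Submodule.mem_sup.1 (h₁.1 u this)
      obtain ⟨z, rfl⟩ := mem_span_singleton'.1 hz
      have : t * (y - r * z) ∈ C := by
        have h3 : t * (y - r * z) = c + r * c' := by linear_combination -h
        rw [h3]
        exact C.add_mem hc (C.mul_mem_left r hc')
      have := (hB _).1 this
      rw [show y = (y - r * z) + z * r by ring]
      exact add_mem (mem_sup_left this)
        (mem_sup_right (mul_mem_left _ _ (mem_span_singleton_self r)))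
    · obtain ⟨b, hb, z, hz, rfl⟩ := Submodule.mem_sup.1 hy
      obtain ⟨z, rfl⟩ := mem_span_singleton'.1 hz
      rw [mul_add, ← mul_assoc]
      exact add_mem (mem_sup_left ((hB b).2 hb))
        (mem_sup_right (mul_mem_left _ _ (mem_span_singleton_self r)))
    · rw [sup_right_comm]
      exact h₁.2

/-- R/(I + x^(n+2)) is an extension of R/(I + x^(n+1)) by R/(I + x), so the tail stays regular by
induction. -/
theorem pow_cons {x : R} {rs : List R} {I : Ideal R} (h : I.IsWeaklyRegularMod (x :: rs)) (n : ℕ) :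
    I.IsWeaklyRegularMod (x ^ (n + 1) :: rs) := by
  have hpow (m : ℕ) : ∀ y, x ^ m * y ∈ I → y ∈ I := by
    induction m with
    | zero => simp
    | succ m ih => exact fun y hy ↦ ih y (h.1 _ (by rwa [← mul_assoc, ← pow_succ']))
  refine ⟨hpow _, ?_⟩
  induction n with
  | zero => simpa using h.2
  | succ n ih =>
    refine of_colon (t := x ^ (n + 1)) (B := I ⊔ span {x}) (fun y ↦ ⟨fun hy ↦ ?_, fun hy ↦ ?_⟩)
      ?_ h.2
    · obtain ⟨i, hi, z, hz, h⟩ := Submodule.mem_sup.1 hy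
      obtain ⟨z, rfl⟩ := mem_span_singleton'.1 hz
      have := hpow (n + 1) (y - z * x) (by
        have h3 : x ^ (n + 1) * (y - z * x) = i := by linear_combination -h
        rwa [h3])
      rw [show y = (y - z * x) + z * x by ring]
      exact add_mem (mem_sup_left this)
        (mem_sup_right (mul_mem_left _ _ (mem_span_singleton_self x)))
    · obtain ⟨i, hi, z, hz, rfl⟩ := Submodule.mem_sup.1 hy
      obtain ⟨z, rfl⟩ := mem_span_singleton'.1 hz
      rw [mul_add]
      refine add_mem (mem_sup_left (mul_mem_left _ _ hi)) (mem_sup_right ?_)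
      rw [mem_span_singleton]
      exact ⟨z, by ring⟩
    · have : span {x ^ (n + 1 + 1)} ≤ span {x ^ (n + 1)} := by
        rw [span_singleton_le_span_singleton]
        exact pow_dvd_pow _ (Nat.le_succ _)
      rwa [sup_assoc, sup_eq_right.2 this]

theorem map_pow {rs : List R} {I : Ideal R} (h : I.IsWeaklyRegularMod rs) (n : ℕ) :
    I.IsWeaklyRegularMod (rs.map (· ^ (n + 1))) := by
  induction rs generalizing I with
  | nil => trivial
  | cons x xs ih =>
    obtain ⟨h₁, h₂⟩ := h.pow_cons n
    exact ⟨h₁, ih h₂⟩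

end Ideal.IsWeaklyRegularMod

/-! ### Flatness from regular sequences -/

/-- The equational criterion for several equations at once: a map from a finite free module to S
killing the columns of `b` factors through a finite free module in which they already die. -/
theorem RingHom.Flat.exists_of_sum_mul_eq_zero {R S : Type*} [CommRing R] [CommRing S]
    {φ : R →+* S} (hφ : φ.Flat) {ι κ : Type*} [Fintype ι] [_root_.Finite κ] (b : ι → κ → R)
    (w : ι → S)
    (h : ∀ j, ∑ i, w i * φ (b i j) = 0) :
    ∃ (k : ℕ) (v : Fin k → ι → R) (y : Fin k → S),
      (∀ l j, ∑ i, v l i * b i j = 0) ∧ ∀ i, w i = ∑ l, y l * φ (v l i) := by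
  classical
  algebraize [φ]
  cases nonempty_fintype κ
  let f : (κ → R) →ₗ[R] (ι → R) := Fintype.linearCombination R fun j i ↦ b i j
  let x : (ι → R) →ₗ[R] S := Fintype.linearCombination R w
  have hf (c i) : f c i = ∑ j, c j * b i j := by
    simp [f, Fintype.linearCombination_apply]
  have hfx : x ∘ₗ f = 0 := by
    refine LinearMap.pi_ext' fun j ↦ LinearMap.ext_ring ?_
    simp only [LinearMap.comp_apply, x, Fintype.linearCombination_apply, hf, LinearMap.coe_single,
      Pi.single_apply, ite_mul, one_mul, zero_mul, Finset.sum_ite_eq', Finset.mem_univ, if_true,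
      LinearMap.zero_apply]
    rw [← h j]
    exact Finset.sum_congr rfl fun i _ ↦ by rw [Algebra.smul_def, mul_comm]; rfl
  obtain ⟨k, a, y, h₁, h₂⟩ := Module.Flat.exists_factorization_of_comp_eq_zero_of_free hfx
  refine ⟨k, fun l i ↦ a (Pi.single i 1) l, fun l ↦ y (Finsupp.single l 1), fun l j ↦ ?_,
    fun i ↦ ?_⟩
  · have := congrArg (fun F ↦ F l) (LinearMap.congr_fun h₂ (Pi.single j 1))
    have hfj : f (Pi.single j 1) = ∑ i, b i j • Pi.single i (1 : R) := by
      ext i; simp [hf, Pi.single_apply]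
    simp only [LinearMap.comp_apply, hfj, map_sum, map_smul] at this
    simpa [mul_comm] using this
  · have := LinearMap.congr_fun h₁ (Pi.single i 1)
    have hx : x (Pi.single i 1) = w i := by simp [x, Fintype.linearCombination_apply_single]
    rw [hx, LinearMap.comp_apply, ← Finsupp.univ_sum_single (a (Pi.single i 1)), map_sum] at this
    rw [this]
    refine Finset.sum_congr rfl fun l _ ↦ ?_
    rw [← mul_one (a _ l), ← smul_eq_mul, ← Finsupp.smul_single, map_smul, Algebra.smul_def,
      mul_comm]
    simp [RingHom.algebraMap_toAlgebra]

/-- Induction on the length: divide by x and φ x, then return by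
`RingHom.Flat.of_quotient_span_singleton`. The base case is a field. -/
theorem RingHom.Flat.of_isWeaklyRegularMod (n : ℕ) {R S : Type*} [CommRing R] [CommRing S]
    [IsNoetherianRing R] [IsNoetherianRing S] [IsLocalRing R] [IsLocalRing S]
    (φ : R →+* S) [IsLocalHom φ] (rs : List R) (hn : rs.length = n)
    (hm : Ideal.ofList rs = IsLocalRing.maximalIdeal R)
    (hreg : (⊥ : Ideal S).IsWeaklyRegularMod (rs.map φ)) : φ.Flat := by
  induction n generalizing R S with
  | zero =>
    rw [List.length_eq_zero_iff] at hn
    subst hn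
    rw [Ideal.ofList_nil] at hm
    exact .of_isField (IsLocalRing.isField_iff_maximalIdeal_eq.2 hm.symm) φ
  | succ n ih =>
    obtain ⟨x, rs, rfl⟩ := List.exists_cons_of_length_eq_add_one hn
    have hxm : x ∈ IsLocalRing.maximalIdeal R := by
      rw [← hm, Ideal.ofList_cons]
      exact Ideal.mem_sup_left (Ideal.mem_span_singleton_self x)
    have hφx : φ x ∈ IsLocalRing.maximalIdeal S := by
      rwa [IsLocalRing.mem_maximalIdeal, mem_nonunits_iff, isUnit_map_iff]
    have : Nontrivial (R ⧸ Ideal.span {x}) := by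
      rw [Ideal.Quotient.nontrivial_iff]
      exact ne_top_of_le_ne_top (IsLocalRing.maximalIdeal.isMaximal R).ne_top
        ((Ideal.span_singleton_le_iff_mem _).2 hxm)
    have : Nontrivial (S ⧸ Ideal.span {φ x}) := by
      rw [Ideal.Quotient.nontrivial_iff]
      exact ne_top_of_le_ne_top (IsLocalRing.maximalIdeal.isMaximal S).ne_top
        ((Ideal.span_singleton_le_iff_mem _).2 hφx)
    have : IsLocalRing (R ⧸ Ideal.span {x}) :=
      IsLocalRing.of_surjective' (Ideal.Quotient.mk _) Ideal.Quotient.mk_surjective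
    have : IsLocalRing (S ⧸ Ideal.span {φ x}) :=
      IsLocalRing.of_surjective' (Ideal.Quotient.mk _) Ideal.Quotient.mk_surjective
    have hlR : IsLocalHom (Ideal.Quotient.mk (Ideal.span {x})) :=
      IsLocalHom.of_surjective _ Ideal.Quotient.mk_surjective
    have hlS : IsLocalHom (Ideal.Quotient.mk (Ideal.span {φ x})) :=
      IsLocalHom.of_surjective _ Ideal.Quotient.mk_surjective
    let ψ : R ⧸ Ideal.span {x} →+* S ⧸ Ideal.span {φ x} :=
      Ideal.quotientMap _ φ (by
        rw [Ideal.span_singleton_le_iff_mem, Ideal.mem_comap]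
        exact Ideal.mem_span_singleton_self _)
    have hψmk (r : R) : ψ (Ideal.Quotient.mk _ r) = Ideal.Quotient.mk _ (φ r) :=
      Ideal.quotientMap_mk
    have hψloc : IsLocalHom ψ := ⟨fun a ha ↦ by
      obtain ⟨r, rfl⟩ := Ideal.Quotient.mk_surjective a
      rw [hψmk] at ha
      exact ((isUnit_map_iff φ r).1 ((isUnit_map_iff _ _).1 ha)).map _⟩
    have hψ : ψ.Flat := by
      refine ih ψ (rs.map (Ideal.Quotient.mk _)) (by simpa using hn) ?_ ?_
      · have h1 := congrArg (Ideal.map (Ideal.Quotient.mk (Ideal.span {x}))) hm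
        rw [Ideal.map_ofList,
          IsLocalRing.map_maximalIdeal_of_surjective _ Ideal.Quotient.mk_surjective] at h1
        rw [← h1, List.map_cons, Ideal.ofList_cons]
        simp
      · rw [List.map_map, show (⇑ψ ∘ ⇑(Ideal.Quotient.mk (Ideal.span {x}))) =
          (Ideal.Quotient.mk (Ideal.span {φ x})) ∘ φ from funext hψmk, ← List.map_map,
          Ideal.IsWeaklyRegularMod.map_iff Ideal.Quotient.mk_surjective,
          ← RingHom.ker_eq_comap_bot, Ideal.mk_ker]
        simpa using hreg.2
    refine .of_quotient_span_singleton φ x ?_ ?_ ?_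
    · exact IsLocalRing.maximalIdeal_le_jacobson _ hφx
    · simpa using hreg.1
    · intro l f w h
      obtain ⟨k, v, y, h₁, h₂⟩ := RingHom.Flat.exists_of_sum_mul_eq_zero hψ (κ := Unit)
        (fun i _ ↦ Ideal.Quotient.mk _ (f i)) (fun i ↦ Ideal.Quotient.mk _ (w i)) (fun _ ↦ by
          rw [← Ideal.Quotient.eq_zero_iff_mem, map_sum] at h
          simp only [hψmk, ← map_mul, mul_comm (w _), h])
      choose v' hv' using fun l i ↦ Ideal.Quotient.mk_surjective (v l i)
      choose y' hy' using fun l ↦ Ideal.Quotient.mk_surjective (y l)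
      refine ⟨k, fun i l ↦ v' l i, y', fun i ↦ ?_, fun l ↦ ?_⟩
      · rw [← Ideal.Quotient.eq_zero_iff_mem, map_sub, map_sum, sub_eq_zero, h₂]
        simp only [map_mul, ← hψmk, hv', hy', mul_comm (y _)]
      · rw [← Ideal.Quotient.eq_zero_iff_mem, map_sum, ← h₁ l ()]
        simp only [map_mul, hv', mul_comm (v _ _)]

/-! ### Regular local rings and Kunz's theorem -/

open IsLocalRing in
-- An x in m outside m² and all minimal primes can replace one of the generators, so induction
-- applies to R/(x), which is a domain. A minimal prime P inside (x) then satisfies P = xP, hence P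
-- = 0 by Nakayama.
theorem IsLocalRing.isDomain_and_exists_isWeaklyRegularMod_of_ringKrullDim_eq (d : ℕ)
    {R : Type*} [CommRing R] [IsLocalRing R] [IsNoetherianRing R] (g : Fin d → R)
    (hg : Ideal.span (Set.range g) = maximalIdeal R) (hdim : d ≤ ringKrullDim R) :
    IsDomain R ∧ ∃ rs : List R, Ideal.ofList rs = maximalIdeal R ∧
      (⊥ : Ideal R).IsWeaklyRegularMod rs := by
  induction d generalizing R with
  | zero =>
    have hbot : maximalIdeal R = ⊥ := by rw [← hg, Set.range_eq_empty, Ideal.span_empty]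
    have hfield := IsLocalRing.isField_iff_maximalIdeal_eq.2 hbot
    exact ⟨hfield.isDomain, [], by simp [hbot], trivial⟩
  | succ d ih =>
    have hheight : maximalIdeal R ∉ minimalPrimes R := by
      intro h
      rw [← Ideal.height_eq_zero_iff] at h
      rw [← maximalIdeal_height_eq_ringKrullDim, h] at hdim
      norm_cast at hdim
    obtain ⟨x, hxm, hx⟩ : ∃ x ∈ maximalIdeal R, x ∉ (maximalIdeal R ^ 2) ∧
        ∀ P ∈ minimalPrimes R, x ∉ P := by
      -- Prime avoidance tolerates the non-prime ideal m²; m ⊆ m² would force m = 0, a minimal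
      -- prime.
      by_contra! hcon
      have hfin := minimalPrimes.finite_of_isNoetherianRing R
      have := (Ideal.subset_union_prime (s := insert (maximalIdeal R ^ 2) hfin.toFinset)
        (f := id) (I := maximalIdeal R) (maximalIdeal R ^ 2) (maximalIdeal R ^ 2)
        (fun P hP hne _ ↦ (by
          have := (Finset.mem_insert.1 hP).resolve_left hne
          exact Ideal.IsMinimalPrime.isPrime (hfin.mem_toFinset.1 this)))).1 (fun x hx ↦ by
          by_cases h2 : x ∈ maximalIdeal R ^ 2
          · exact Set.mem_biUnion (by simp) h2
          · obtain ⟨P, hP, hxP⟩ := hcon x hx h2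
            exact Set.mem_biUnion (x := P) (by simp [hP]) hxP)
      obtain ⟨P, hP, hle⟩ := this
      rcases Finset.mem_insert.1 hP with rfl | hP
      · have hbot : maximalIdeal R = ⊥ := by
          refine Submodule.eq_bot_of_le_smul_of_le_jacobson_bot (maximalIdeal R) _
            (IsNoetherian.noetherian _) ?_ (maximalIdeal_le_jacobson _)
          rwa [smul_eq_mul, ← sq]
        refine hheight ?_
        exact ⟨⟨inferInstance, bot_le⟩, fun _ _ _ ↦ hbot ▸ bot_le⟩
      · have hP := hfin.mem_toFinset.1 hP
        have := Ideal.IsMinimalPrime.isPrime hP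
        exact hheight (le_antisymm hle (le_maximalIdeal this.ne_top) ▸ hP)
    obtain ⟨hx2, hxP⟩ := hx
    obtain ⟨c, hc⟩ := (Ideal.mem_span_range_iff_exists_fun).1 (hg.symm ▸ hxm)
    obtain ⟨i, hi⟩ : ∃ i, IsUnit (c i) := by
      by_contra! hcon
      apply hx2
      rw [← hc, sq]
      exact Ideal.sum_mem _ fun i _ ↦ Ideal.mul_mem_mul ((mem_maximalIdeal _).2 (hcon i))
        (hg ▸ Ideal.subset_span ⟨i, rfl⟩)
    set I := Ideal.span {x}
    have hIm : I ≤ maximalIdeal R := (Ideal.span_singleton_le_iff_mem _).2 hxm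
    have : Nontrivial (R ⧸ I) := Ideal.Quotient.nontrivial_iff.2
      (ne_top_of_le_ne_top (maximalIdeal.isMaximal R).ne_top hIm)
    have : IsLocalRing (R ⧸ I) :=
      IsLocalRing.of_surjective' (Ideal.Quotient.mk _) Ideal.Quotient.mk_surjective
    have hmap := IsLocalRing.map_maximalIdeal_of_surjective (Ideal.Quotient.mk I)
      Ideal.Quotient.mk_surjective
    have hspan : Ideal.span (Set.range fun j ↦ Ideal.Quotient.mk I (g (i.succAbove j))) =
        maximalIdeal (R ⧸ I) := by
      refine le_antisymm ?_ ?_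
      · rw [Ideal.span_le]
        rintro _ ⟨j, rfl⟩
        rw [← hmap]
        exact Ideal.mem_map_of_mem _ (hg ▸ Ideal.subset_span ⟨_, rfl⟩)
      · rw [← hmap, Ideal.map_le_iff_le_comap, ← hg, Ideal.span_le]
        have hother (j : Fin d) : Ideal.Quotient.mk I (g (i.succAbove j)) ∈
            Ideal.span (Set.range fun j ↦ Ideal.Quotient.mk I (g (i.succAbove j))) :=
          Ideal.subset_span ⟨j, rfl⟩
        rintro _ ⟨j, rfl⟩
        rw [SetLike.mem_coe, Ideal.mem_comap]
        rcases Fin.eq_self_or_eq_succAbove i j with rfl | ⟨j, rfl⟩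
        · have h1 : Ideal.Quotient.mk I x = 0 :=
            Ideal.Quotient.eq_zero_iff_mem.2 (Ideal.mem_span_singleton_self x)
          rw [← hc, Fin.sum_univ_succAbove _ j, map_add, map_mul] at h1
          rw [← Ideal.unit_mul_mem_iff_mem _ (hi.map (Ideal.Quotient.mk I)),
            eq_neg_of_add_eq_zero_left h1, map_sum]
          refine neg_mem (Ideal.sum_mem _ fun k _ ↦ ?_)
          rw [map_mul]
          exact Ideal.mul_mem_left _ _ (hother k)
        · exact hother j
    have hdim' : (d : WithBot ℕ∞) ≤ ringKrullDim (R ⧸ I) := by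
      have h1 := ringKrullDim_le_ringKrullDim_quotient_add_card (R := R) {x}
        (by simpa [ringJacobson_eq_maximalIdeal] using hxm)
      rw [Finset.coe_singleton, Finset.card_singleton] at h1
      have h3 := hdim.trans h1
      push_cast at h3
      exact (ENat.WithBot.add_le_add_one_right_iff).1 h3
    obtain ⟨hdom, rs, hrs, hreg⟩ := ih _ hspan hdim'
    obtain ⟨rs, rfl⟩ := List.map_surjective_iff.2 Ideal.Quotient.mk_surjective rs
    have hprime : I.IsPrime := (Ideal.Quotient.isDomain_iff_prime I).1 hdom
    have hR : IsDomain R := by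
      obtain ⟨P, hP, hPI⟩ := Ideal.exists_minimalPrimes_le (I := ⊥) (J := I) bot_le
      have hPp := Ideal.IsMinimalPrime.isPrime hP
      have hPbot : P = ⊥ := by
        refine Submodule.eq_bot_of_le_smul_of_le_jacobson_bot (maximalIdeal R) _
            (IsNoetherian.noetherian _) (fun y hy ↦ ?_) (maximalIdeal_le_jacobson _)
        obtain ⟨z, rfl⟩ := Ideal.mem_span_singleton'.1 (hPI hy)
        rw [mul_comm]
        exact Submodule.smul_mem_smul hxm ((hPp.mem_or_mem hy).resolve_right (hxP P hP))
      rw [hPbot] at hPp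
      exact IsDomain.of_bot_isPrime R
    refine ⟨hR, x :: rs, ?_, ?_, ?_⟩
    · rw [← Ideal.map_ofList, ← hmap] at hrs
      have := congrArg (Ideal.comap (Ideal.Quotient.mk I)) hrs
      rw [Ideal.comap_map_of_surjective _ Ideal.Quotient.mk_surjective,
        Ideal.comap_map_of_surjective _ Ideal.Quotient.mk_surjective, ← RingHom.ker_eq_comap_bot,
        Ideal.mk_ker, sup_eq_left.2 hIm] at this
      rw [Ideal.ofList_cons, sup_comm, this]
    · intro y hy
      refine (mul_eq_zero.1 (Ideal.mem_bot.1 hy)).resolve_left ?_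
      rintro rfl
      exact hx2 (zero_mem _)
    · rwa [Ideal.IsWeaklyRegularMod.map_iff Ideal.Quotient.mk_surjective,
          ← RingHom.ker_eq_comap_bot, Ideal.mk_ker, ← bot_sup_eq I] at hreg

theorem IsRegularLocalRing.isDomain_and_exists_isWeaklyRegularMod (R : Type*) [CommRing R]
    [IsRegularLocalRing R] :
    IsDomain R ∧ ∃ rs : List R, Ideal.ofList rs = IsLocalRing.maximalIdeal R ∧
      (⊥ : Ideal R).IsWeaklyRegularMod rs := by
  have h := IsRegularLocalRing.spanFinrank_maximalIdeal (R := R)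
  have hfg := (IsLocalRing.maximalIdeal R).fg_of_isNoetherianRing
  obtain ⟨s, hs, hspan⟩ :=
    Submodule.FG.exists_span_finset_card_eq_spanFinrank hfg
  exact IsLocalRing.isDomain_and_exists_isWeaklyRegularMod_of_ringKrullDim_eq _
    (Subtype.val ∘ s.equivFin.symm)
    (by rw [s.equivFin.symm.surjective.range_comp]; simpa using! hspan) (hs ▸ h.le)

theorem IsRegularLocalRing.isDomain (R : Type*) [CommRing R] [IsRegularLocalRing R] :
    IsDomain R :=
  (isDomain_and_exists_isWeaklyRegularMod R).1

/-- Kunz: the Frobenius endomorphism of a regular local ring is flat. -/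
theorem IsRegularLocalRing.flat_frobenius (R : Type*) [CommRing R] [IsRegularLocalRing R]
    (p : ℕ) [Fact p.Prime] [CharP R p] : (frobenius R p).Flat := by
  obtain ⟨rs, hrs, hreg⟩ := (isDomain_and_exists_isWeaklyRegularMod R).2
  have : IsLocalHom (frobenius R p) :=
    ⟨fun a ha ↦ (isUnit_pow_iff (Fact.out : p.Prime).ne_zero).1 (by rwa [← frobenius_def])⟩
  refine .of_isWeaklyRegularMod _ _ rs rfl hrs ?_
  -- Frobenius sends the sequence to its p-th powers; `map_pow` raises to its argument plus one.
  have := hreg.map_pow (p - 1)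
  rw [Nat.sub_add_cancel (Fact.out : p.Prime).one_le] at this
  exact this

/-! ### Descending relations along Frobenius -/

namespace IsRegularLocalRing

variable {R : Type*} [CommRing R] [IsRegularLocalRing R] (p : ℕ) [Fact p.Prime] [CharP R p]
  (K : Type*) [Field K] [Algebra R K] [IsFractionRing R K]
  {L : Type*} [Field L] [Algebra R L] [Algebra K L] [IsScalarTower R K L]
  [FiniteDimensional K L] [Algebra.IsSeparable K L]

include K in
/-- Relations among `p`-th powers in a finite separable extension of the fraction field come from
relations among the original elements. -/
theorem exists_of_sum_smul_pow_eq_zero {ι : Type*} [Fintype ι] (s : ι → L) (w : ι → R)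
    (h : ∑ i, w i • s i ^ p = 0) :
    ∃ (k : ℕ) (v : Fin k → ι → R) (y : Fin k → R),
      (∀ l, ∑ i, v l i • s i = 0) ∧ ∀ i, w i = ∑ l, y l * v l i ^ p := by
  have := IsRegularLocalRing.isDomain R
  have : FaithfulSMul R L := by
    have := IsFractionRing.injective R K
    rw [faithfulSMul_iff_algebraMap_injective, IsScalarTower.algebraMap_eq R K L]
    exact (algebraMap K L).injective.comp this
  have : CharP K p := charP_of_injective_ringHom (IsFractionRing.injective R K) p
  have : CharP L p := charP_of_injective_ringHom (algebraMap K L).injective p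
  have : ExpChar K p := .prime Fact.out
  let e := Module.finBasis K L
  obtain ⟨b, hb⟩ := IsLocalization.exist_integer_multiples_of_finite (nonZeroDivisors R)
    fun ij : ι × Fin (Module.finrank K L) ↦ e.repr (s ij.1) ij.2
  choose B hB using hb
  have hs (i : ι) : (b : R) • s i = ∑ j, B (i, j) • e j := by
    conv_lhs => rw [← e.sum_repr (s i)]
    rw [Finset.smul_sum]
    refine Finset.sum_congr rfl fun j _ ↦ ?_
    rw [← smul_assoc, ← hB (i, j), algebraMap_smul]
  have hb0 : (b : R) ≠ 0 := nonZeroDivisors.ne_zero b.2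
  have hli : LinearIndependent R fun j ↦ e j ^ p := by
    have := e.linearIndependent.map_pow_expChar_pow_of_isSeparable p 1
    simp only [pow_one] at this
    exact this.restrict_scalars (by
      simpa [Algebra.smul_def] using IsFractionRing.injective R K)
  -- Multiplication by `b ^ p` clears denominators; comparing coefficients of the `e j ^ p` leaves
  -- equations in R, where flatness of Frobenius applies.
  have hzero (j) : ∑ i, w i * B (i, j) ^ p = 0 := by
    refine Fintype.linearIndependent_iff.1 hli (fun j ↦ ∑ i, w i * B (i, j) ^ p) ?_ j
    have h1 := congrArg (fun z ↦ (b : R) ^ p • z) h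
    simp only [Finset.smul_sum, smul_zero] at h1
    rw [← h1]
    simp only [Finset.sum_smul]
    rw [Finset.sum_comm]
    refine Finset.sum_congr rfl fun i _ ↦ ?_
    rw [smul_comm, ← smul_pow, hs, sum_pow_char, Finset.smul_sum]
    refine Finset.sum_congr rfl fun j _ ↦ ?_
    rw [smul_pow, mul_smul]
  obtain ⟨k, v, y, h₁, h₂⟩ := RingHom.Flat.exists_of_sum_mul_eq_zero
    (IsRegularLocalRing.flat_frobenius R p) (fun i j ↦ B (i, j)) w hzero
  refine ⟨k, v, y, fun l ↦ ?_, h₂⟩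
  rw [← smul_right_injective L hb0 |>.eq_iff]
  simp only [Finset.smul_sum, smul_zero, smul_comm (b : R), hs]
  rw [Finset.sum_comm]
  simp only [← mul_smul, ← Finset.sum_smul, h₁ l, zero_smul, Finset.sum_const_zero]

include K in
-- The coefficient -1 of `x ^ p` is a combination of p-th powers of coefficients of x in descended
-- relations. As R is local, one of these is a unit, and that relation is solved for x.
theorem mem_span_of_pow_mem_span {ι : Type*} [Fintype ι] (s : ι → L) (x : L)
    (h : x ^ p ∈ Submodule.span R (Set.range fun i ↦ s i ^ p)) :
    x ∈ Submodule.span R (Set.range s) := by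
  obtain ⟨r, hr⟩ := (Submodule.mem_span_range_iff_exists_fun R).1 h
  obtain ⟨k, v, y, h₁, h₂⟩ := exists_of_sum_smul_pow_eq_zero p K
    (fun o : Option ι ↦ o.elim x s) (fun o ↦ o.elim (-1) r) (by simp [Fintype.sum_option, hr])
  obtain ⟨l, hl⟩ : ∃ l, IsUnit (v l none) := by
    by_contra! hcon
    have : (-1 : R) ∈ IsLocalRing.maximalIdeal R := by
      have := h₂ none
      simp only [Option.elim_none] at this
      rw [this]
      exact Ideal.sum_mem _ fun l _ ↦ Ideal.mul_mem_left _ _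
        (Ideal.pow_mem_of_mem _ ((IsLocalRing.mem_maximalIdeal _).2 (hcon l)) _
          (Fact.out : p.Prime).pos)
    exact (IsLocalRing.mem_maximalIdeal _).1 this isUnit_one.neg
  have := h₁ l
  simp only [Fintype.sum_option, Option.elim_none, Option.elim_some] at this
  have hx := eq_neg_of_add_eq_zero_left this
  rw [← hl.unit_spec, ← Units.smul_def, ← eq_inv_smul_iff] at hx
  rw [hx, Units.smul_def]
  exact Submodule.smul_mem _ _ (Submodule.neg_mem _ (Submodule.sum_mem _ fun i _ ↦
    Submodule.smul_mem _ _ (Submodule.subset_span ⟨i, rfl⟩)))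

include K in
theorem mem_span_of_pow_pow_mem_span {ι : Type*} [Fintype ι] (m : ℕ) (s : ι → L) (x : L)
    (h : x ^ p ^ m ∈ Submodule.span R (Set.range fun i ↦ s i ^ p ^ m)) :
    x ∈ Submodule.span R (Set.range s) := by
  induction m with
  | zero => simpa using h
  | succ m ih =>
    refine ih (mem_span_of_pow_mem_span p K _ _ ?_)
    simpa only [← pow_mul, ← pow_succ] using h

include K in
-- With C and D the matrices of `h₁` and `h₂`, the rows of 1 - CD are relations, so C is invertible
-- modulo m and hence over R. A relation v gives the relation vC among p-th powers; by descent its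
-- entries are combinations of p-th powers of relation coefficients, so lie in mJ. Thus J = mJ = 0.
theorem linearIndependent_of_mem_span_pow {ι : Type*} [Fintype ι] [DecidableEq ι] (s : ι → L)
    (hmin : ∀ v : ι → R, ∑ i, v i • s i = 0 → ∀ i, v i ∈ IsLocalRing.maximalIdeal R)
    (h₁ : ∀ i, s i ∈ Submodule.span R (Set.range fun i ↦ s i ^ p))
    (h₂ : ∀ i, s i ^ p ∈ Submodule.span R (Set.range s)) : LinearIndependent R s := by
  choose c hc using fun i ↦ (Submodule.mem_span_range_iff_exists_fun R).1 (h₁ i)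
  choose d hd using fun i ↦ (Submodule.mem_span_range_iff_exists_fun R).1 (h₂ i)
  have hcd (i k) : ((1 : Matrix ι ι R) - Matrix.of c * Matrix.of d) i k ∈
      IsLocalRing.maximalIdeal R := by
    refine hmin _ ?_ k
    simp only [Matrix.sub_apply, sub_smul, Finset.sum_sub_distrib, Matrix.one_apply, ite_smul,
      one_smul, zero_smul, Finset.sum_ite_eq, Finset.mem_univ, if_true, Matrix.mul_apply,
      Matrix.of_apply, Finset.sum_smul, mul_smul]
    rw [Finset.sum_comm]
    simp only [← Finset.smul_sum, hd, hc, sub_self]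
  have hunit : IsUnit (Matrix.of c).det := by
    have h1 : ((IsLocalRing.residue R).mapMatrix (Matrix.of c * Matrix.of d)) = 1 := by
      rw [eq_comm, ← sub_eq_zero, ← map_one (IsLocalRing.residue R).mapMatrix, ← map_sub]
      ext i k
      exact (IsLocalRing.residue_eq_zero_iff _).2 (hcd i k)
    have h2 : IsUnit (Matrix.of c * Matrix.of d).det := by
      rw [← isUnit_map_iff (IsLocalRing.residue R), RingHom.map_det, h1, Matrix.det_one]
      exact isUnit_one
    rw [Matrix.det_mul] at h2
    exact isUnit_of_mul_isUnit_left h2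
  let J : Ideal R := Ideal.span {r | ∃ v : ι → R, ∑ i, v i • s i = 0 ∧ ∃ i, v i = r}
  have hJm : J ≤ IsLocalRing.maximalIdeal R := by
    rw [Ideal.span_le]
    rintro _ ⟨v, hv, i, rfl⟩
    exact hmin v hv i
  have hJ : J = ⊥ := by
    refine Submodule.eq_bot_of_le_smul_of_le_jacobson_bot (IsLocalRing.maximalIdeal R) _
      (IsNoetherian.noetherian _) ?_ (IsLocalRing.maximalIdeal_le_jacobson _)
    refine Ideal.span_le.2 ?_
    rintro _ ⟨v, hv, i, rfl⟩
    have hw : ∑ j, (Matrix.vecMul v (Matrix.of c)) j • s j ^ p = 0 := by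
      rw [← hv]
      simp only [Matrix.vecMul, dotProduct, Matrix.of_apply, Finset.sum_smul, mul_smul]
      rw [Finset.sum_comm]
      simp only [← Finset.smul_sum, hc]
    obtain ⟨k, u, y, h₃, h₄⟩ := exists_of_sum_smul_pow_eq_zero p K s _ hw
    have hmem (j) : (Matrix.vecMul v (Matrix.of c)) j ∈ IsLocalRing.maximalIdeal R • J := by
      rw [h₄]
      refine Ideal.sum_mem _ fun l _ ↦ Ideal.mul_mem_left _ _ ?_
      rw [← Nat.sub_add_cancel (Fact.out : p.Prime).one_le, pow_succ]
      exact Submodule.smul_mem_smul (Ideal.pow_mem_of_mem _ (hmin _ (h₃ l) j) _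
        (Nat.sub_pos_of_lt (Fact.out : p.Prime).one_lt)) (Ideal.subset_span ⟨_, h₃ l, j, rfl⟩)
    have hv' : v = Matrix.vecMul (Matrix.vecMul v (Matrix.of c)) (Matrix.of c)⁻¹ := by
      rw [Matrix.vecMul_vecMul, Matrix.mul_nonsing_inv _ hunit, Matrix.vecMul_one]
    rw [hv']
    exact Ideal.sum_mem _ fun j _ ↦ Ideal.mul_mem_right _ _ (hmem j)
  rw [Fintype.linearIndependent_iff]
  intro v hv i
  have : v i ∈ J := Ideal.subset_span ⟨v, hv, i, rfl⟩
  rwa [hJ, Ideal.mem_bot] at this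

end IsRegularLocalRing

/-! ### Étaleness over a regular local ring -/

/-- If every element of a characteristic `p` algebra is a linear combination of `p`-th powers, then
the algebra is formally unramified. -/
theorem Algebra.FormallyUnramified.of_mem_span_range_pow (p : ℕ) [Fact p.Prime] {R A : Type*}
    [CommRing R] [CommRing A] [Algebra R A] [CharP A p]
    (h : ∀ a : A, a ∈ Submodule.span R (Set.range fun b : A ↦ b ^ p)) :
    Algebra.FormallyUnramified R A := by
  rw [Algebra.formallyUnramified_iff]
  have hD (a : A) : KaehlerDifferential.D R A a = 0 := by
    induction h a using Submodule.span_induction with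
    | mem x hx =>
      obtain ⟨b, rfl⟩ := hx
      simp only [Derivation.leibniz_pow]
      rw [← Nat.cast_smul_eq_nsmul A, CharP.cast_eq_zero, zero_smul]
    | zero => simp
    | add x y _ _ hx hy => rw [map_add, hx, hy, add_zero]
    | smul r x _ hx => rw [Derivation.map_smul, hx, smul_zero]
  have hspan := KaehlerDifferential.span_range_derivation R A
  have hbot : Submodule.span A (Set.range (KaehlerDifferential.D R A)) = ⊥ := by
    rw [Submodule.span_eq_bot]
    rintro _ ⟨a, rfl⟩
    exact hD a
  rw [hbot] at hspan
  exact (Submodule.subsingleton_iff A).1 (subsingleton_of_bot_eq_top hspan)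

namespace IsRegularLocalRing

variable {R : Type*} [CommRing R] [IsRegularLocalRing R] (p : ℕ) [Fact p.Prime] [CharP R p]
  (K : Type*) [Field K] [Algebra R K] [IsFractionRing R K]
  {L : Type*} [Field L] [Algebra R L] [Algebra K L] [IsScalarTower R K L]
  [FiniteDimensional K L] [Algebra.IsSeparable K L]

include K in
theorem exists_linearIndependent_span_eq (A : Subalgebra R L) {ι : Type*} [Fintype ι] (s : ι → L)
    (h₁ : Submodule.span R (Set.range s) = Subalgebra.toSubmodule A)
    (h₂ : Submodule.span R (Set.range fun i ↦ s i ^ p) = Subalgebra.toSubmodule A) :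
    ∃ (t : Finset L), LinearIndependent R (Subtype.val : t → L) ∧
      Submodule.span R (t : Set L) = Subalgebra.toSubmodule A := by
  classical
  have : CharP K p := charP_of_injective_ringHom (IsFractionRing.injective R K) p
  have : CharP L p := charP_of_injective_ringHom (algebraMap K L).injective p
  -- By minimality no relation has a unit coefficient: it would make a generator redundant.
  obtain ⟨t, ht⟩ := exists_minimal_of_wellFoundedLT
    (fun t : Finset L ↦ Submodule.span R (t : Set L) = Subalgebra.toSubmodule A)
    ⟨Finset.univ.image s, by simpa using h₁⟩
  refine ⟨t, linearIndependent_of_mem_span_pow p K _ (fun v hv i ↦ ?_) (fun i ↦ ?_) (fun i ↦ ?_),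
    ht.prop⟩
  · by_contra hvi
    have hvi : IsUnit (v i) := by simpa using hvi
    have hle : Submodule.span R (t : Set L) =
        Submodule.span R ((t.erase i : Finset L) : Set L) := by
      refine le_antisymm (Submodule.span_le.2 fun x hx ↦ ?_)
        (Submodule.span_mono (Finset.coe_subset.2 (Finset.erase_subset _ _)))
      by_cases hxi : x = i
      · subst hxi
        rw [← Finset.add_sum_erase _ _ (Finset.mem_univ i)] at hv
        have hx := eq_neg_of_add_eq_zero_left hv
        rw [← hvi.unit_spec, ← Units.smul_def, ← eq_inv_smul_iff] at hx
        generalize hN : Submodule.span R ((t.erase i : Finset L) : Set L) = N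
        rw [hx, Units.smul_def, ← hN]
        refine Submodule.smul_mem _ _ (Submodule.neg_mem _ (Submodule.sum_mem _ fun j hj ↦
          Submodule.smul_mem _ _ (Submodule.subset_span ?_)))
        exact Finset.mem_coe.2 (Finset.mem_erase.2
          ⟨Subtype.coe_ne_coe.2 (Finset.ne_of_mem_erase hj), j.2⟩)
      · exact Submodule.subset_span (Finset.mem_coe.2 (Finset.mem_erase.2 ⟨hxi, hx⟩))
    have := ht.le_of_le (hle.symm.trans ht.prop) (Finset.erase_subset _ _)
    exact Finset.notMem_erase _ _ (this i.2)
  · have hi : (i : L) ∈ Subalgebra.toSubmodule A := ht.prop ▸ Submodule.subset_span i.2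
    rw [← h₂] at hi
    refine Submodule.span_le.2 ?_ hi
    rintro _ ⟨j, rfl⟩
    have hj : s j ∈ Submodule.span R (Set.range (Subtype.val : t → L)) := by
      rw [Subtype.range_coe_subtype, show {x | x ∈ t} = (t : Set L) from rfl, ht.prop, ← h₁]
      exact Submodule.subset_span ⟨j, rfl⟩
    obtain ⟨r, hr⟩ := (Submodule.mem_span_range_iff_exists_fun R).1 hj
    simp only [← hr, SetLike.mem_coe, sum_pow_char]
    refine Submodule.sum_mem _ fun l _ ↦ ?_
    rw [smul_pow]
    exact Submodule.smul_mem _ _ (Submodule.subset_span ⟨l, rfl⟩)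
  · rw [Subtype.range_coe_subtype, show {x | x ∈ t} = (t : Set L) from rfl, ht.prop]
    exact A.pow_mem (show (i : L) ∈ Subalgebra.toSubmodule A from
      ht.prop ▸ Submodule.subset_span i.2) p

include K in
/-- A local reduced algebra `S` over a regular local ring `R` of characteristic `p` mapping to a
finite separable extension of the fraction field is étale over `R`, if its elements satisfy the
finiteness condition expressing that `S` generates its perfect closure as a finite module over the
perfect closure of `R`. -/
theorem etale_of_algHom {S : Type*} [CommRing S] [IsLocalRing S] [IsReduced S] [CharP S p]
    [Algebra R S] (f : S →ₐ[R] L) {ι : Type*} [Fintype ι] (s : ι → S)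
    (H : ∀ (x : S) (n : ℕ), ∃ (m : ℕ) (r : ι → R), x ^ p ^ m = ∑ i, r i • s i ^ p ^ (m + n)) :
    Algebra.Etale R S := by
  have := IsRegularLocalRing.isDomain R
  have : CharP K p := charP_of_injective_ringHom (IsFractionRing.injective R K) p
  have : CharP L p := charP_of_injective_ringHom (algebraMap K L).injective p
  have : ExpChar K p := .prime Fact.out
  have hspan (n : ℕ) : Submodule.span R (Set.range fun i ↦ f (s i) ^ p ^ n) =
      Subalgebra.toSubmodule f.range := by
    refine le_antisymm (Submodule.span_le.2 ?_) ?_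
    · rintro _ ⟨i, rfl⟩
      exact ⟨s i ^ p ^ n, map_pow f _ _⟩
    · rintro _ ⟨x, rfl⟩
      obtain ⟨m, r, hr⟩ := H x n
      refine mem_span_of_pow_pow_mem_span p K m _ _ ?_
      refine (Submodule.mem_span_range_iff_exists_fun R).2 ⟨r, ?_⟩
      have := congrArg f hr
      simp only [map_pow, map_sum, map_smul] at this
      simp only [← pow_mul, ← pow_add, add_comm n m]
      exact this.symm
  have hspan₁ : Submodule.span R (Set.range fun i ↦ f (s i) ^ p) =
      Subalgebra.toSubmodule f.range := by simpa using hspan 1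
  obtain ⟨t, ht, htspan⟩ := exists_linearIndependent_span_eq p K f.range (fun i ↦ f (s i))
    (by simpa using hspan 0) hspan₁
  have : CharP f.range p := f.range.val.toRingHom.charP Subtype.val_injective p
  have hunram : Algebra.FormallyUnramified R f.range := by
    refine .of_mem_span_range_pow p fun a ↦ ?_
    have ha : (a : L) ∈ Submodule.span R (Set.range fun i ↦ f (s i) ^ p) := hspan₁ ▸ a.2
    obtain ⟨r, hr⟩ := (Submodule.mem_span_range_iff_exists_fun R).1 ha
    have : a = ∑ i, r i • (f.rangeRestrict (s i)) ^ p := by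
      ext
      rw [← hr]
      simp
    rw [this]
    exact Submodule.sum_mem _ fun i _ ↦ Submodule.smul_mem _ _ (Submodule.subset_span ⟨_, rfl⟩)
  let b : Module.Basis t R f.range :=
    (Module.Basis.span ht).map (LinearEquiv.ofEq _ (Subalgebra.toSubmodule f.range) (by
      rw [Subtype.range_coe_subtype, show {x | x ∈ t} = (t : Set L) from rfl, htspan]))
  have : Module.Free R f.range := .of_basis b
  have : Module.Finite R f.range := .of_basis b
  have : Algebra.FinitePresentation R f.range :=
    Algebra.FinitePresentation.of_finiteType.1 inferInstance
  have : Algebra.Etale R f.range := .of_formallyUnramified_of_flat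
  have hinj : Function.Injective f := by
    have hli (q : ℕ) : LinearIndependent R fun a : t ↦ (a : L) ^ p ^ q := by
      have := ((LinearIndependent.iff_fractionRing R K).1 ht).map_pow_expChar_pow_of_isSeparable p q
      exact (LinearIndependent.iff_fractionRing R K).2 this
    have hlift (a : t) : ∃ α, f α = a :=
      (htspan ▸ Submodule.subset_span a.2 : (a : L) ∈ Subalgebra.toSubmodule f.range)
    choose α hα using hlift
    have hcoef (i) : ∃ c : t → R, ∑ a, c a • (a : L) = f (s i) := by
      refine (Submodule.mem_span_range_iff_exists_fun R).1 ?_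
      rw [Subtype.range_coe_subtype, show {x | x ∈ t} = (t : Set L) from rfl, htspan]
      exact ⟨s i, rfl⟩
    choose c hc using hcoef
    -- Subtracting lifts of the basis expansion moves `s i` into the kernel of f.
    let u (i : ι) : S := s i - ∑ a, c i a • α a
    have hu (i) : f (u i) = 0 := by
      simp only [u, map_sub, map_sum, map_smul, hα, hc, sub_self]
    -- On the kernel, `H` holds with u in place of s: after applying f, independence of the basis
    -- powers kills the remaining coefficients.
    have key (x : S) (hx : f x = 0) (n : ℕ) :
        ∃ (m : ℕ) (r : ι → R), x ^ p ^ m = ∑ i, r i • u i ^ p ^ (m + n) := by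
      obtain ⟨m, r, hr⟩ := H x n
      have hsi (i) : s i ^ p ^ (m + n) =
          u i ^ p ^ (m + n) + ∑ a, c i a ^ p ^ (m + n) • α a ^ p ^ (m + n) := by
        simp only [← smul_pow]
        rw [← sum_pow_char_pow, ← add_pow_char_pow, sub_add_cancel]
      have hsum : ∑ i, r i • s i ^ p ^ (m + n) = ∑ i, r i • u i ^ p ^ (m + n) +
          ∑ a, (∑ i, r i * c i a ^ p ^ (m + n)) • α a ^ p ^ (m + n) := by
        simp only [hsi, smul_add, Finset.sum_add_distrib, Finset.smul_sum, Finset.sum_smul,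
          mul_smul]
        rw [Finset.sum_comm (γ := t)]
      rw [hsum] at hr
      have hzero : ∀ a, ∑ i, r i * c i a ^ p ^ (m + n) = 0 := by
        refine Fintype.linearIndependent_iff.1 (hli (m + n)) _ ?_
        have := congrArg f hr
        have hpos (k : ℕ) : p ^ k ≠ 0 := pow_ne_zero _ (Fact.out : p.Prime).ne_zero
        simpa only [map_pow, map_add, map_sum, map_smul, hx, hu, hα, zero_pow (hpos _), smul_zero,
          Finset.sum_const_zero, zero_add] using this.symm
      exact ⟨m, r, by simpa [hzero] using hr⟩
    choose m r hr using fun i ↦ key (u i) (hu i) 1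
    -- A common exponent makes the ideal U of the `u i ^ p ^ M` satisfy U ⊆ m_S U. It is finitely
    -- generated, so Nakayama works without S being Noetherian.
    let M := ∑ i, m i
    have hrM (i) : u i ^ p ^ M = ∑ j, r i j ^ p ^ (M - m i) • u j ^ p ^ (M + 1) := by
      have hle : m i ≤ M := Finset.single_le_sum (fun _ _ ↦ Nat.zero_le _) (Finset.mem_univ i)
      have := congrArg (· ^ p ^ (M - m i)) (hr i)
      simp only [sum_pow_char_pow, smul_pow, ← pow_mul, ← pow_add, Nat.add_sub_cancel' hle] at this
      rw [this]
      refine Finset.sum_congr rfl fun j _ ↦ ?_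
      rw [show m i + 1 + (M - m i) = M + 1 by omega]
    have hum (i) : u i ∈ IsLocalRing.maximalIdeal S := by
      rw [IsLocalRing.mem_maximalIdeal, mem_nonunits_iff]
      intro h
      exact (h.map f).ne_zero (hu i)
    have hU : Ideal.span (Set.range fun i ↦ u i ^ p ^ M) = ⊥ := by
      refine Submodule.eq_bot_of_le_smul_of_le_jacobson_bot (IsLocalRing.maximalIdeal S) _
        (Submodule.fg_span (Set.finite_range _)) ?_ (IsLocalRing.maximalIdeal_le_jacobson _)
      refine Ideal.span_le.2 ?_
      rintro _ ⟨i, rfl⟩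
      simp only [SetLike.mem_coe, hrM i]
      refine Submodule.sum_mem _ fun j _ ↦ ?_
      rw [Algebra.smul_def (r i j ^ _), ← smul_eq_mul]
      refine Submodule.smul_mem _ _ ?_
      rw [pow_succ p, pow_mul, ← Nat.sub_add_cancel (Fact.out : p.Prime).one_le, pow_succ]
      refine Submodule.smul_mem_smul (Ideal.pow_mem_of_mem _ (Ideal.pow_mem_of_mem _ (hum j) _ ?_) _
        (Nat.sub_pos_of_lt (Fact.out : p.Prime).one_lt)) (Ideal.subset_span ⟨j, ?_⟩)
      · have := (Fact.out : p.Prime).pos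
        positivity
      · simp [Nat.sub_add_cancel (Fact.out : p.Prime).one_le]
    have hu0 (i) : u i = 0 := by
      rw [Ideal.span_eq_bot] at hU
      exact eq_zero_of_pow_eq_zero (hU _ ⟨i, rfl⟩)
    rw [injective_iff_map_eq_zero]
    intro x hx
    obtain ⟨m, r, hr⟩ := key x hx 0
    have hpos (k : ℕ) : p ^ k ≠ 0 := pow_ne_zero _ (Fact.out : p.Prime).ne_zero
    simp only [hu0, zero_pow (hpos _), smul_zero, Finset.sum_const_zero] at hr
    exact eq_zero_of_pow_eq_zero hr
  exact .of_equiv (AlgEquiv.ofInjective f hinj).symm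

end IsRegularLocalRing

theorem IsRegularLocalRing.etale_of_genericallyEtale (p : ℕ) [Fact p.Prime]
    (R : Type*) [CommRing R] [IsRegularLocalRing R] [CharP R p]
    (S : Type*) [CommRing S] [IsLocalRing S] [IsReduced S] [CharP S p] [Algebra R S]
    (hgen : GenericallyEtale R S) (hne : Nontrivial (FractionRing R ⊗[R] S))
    {ι : Type*} [Fintype ι] (s : ι → S)
    (H : ∀ (x : S) (n : ℕ), ∃ (m : ℕ) (r : ι → R), x ^ p ^ m = ∑ i, r i • s i ^ p ^ (m + n)) :
    Algebra.Etale R S := by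
  have := IsRegularLocalRing.isDomain R
  let K := FractionRing R
  have : Algebra.Etale K (K ⊗[R] S) := hgen
  -- One residue field of the generic fibre suffices: injectivity of S → L will follow from `H`.
  obtain ⟨M, hM⟩ := Ideal.exists_maximal (K ⊗[R] S)
  let L := (K ⊗[R] S) ⧸ M
  let : Field L := Ideal.Quotient.field M
  have hsurj : Function.Surjective (IsScalarTower.toAlgHom K (K ⊗[R] S) L) :=
    Ideal.Quotient.mk_surjective
  have : Algebra.FiniteType K L := .of_surjective _ hsurj
  have : Algebra.FormallyUnramified K L := .of_surjective _ hsurj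
  have : FiniteDimensional K L := Algebra.FormallyUnramified.finite_of_free K L
  have : Algebra.IsSeparable K L := Algebra.FormallyUnramified.isSeparable K L
  exact etale_of_algHom p K (L := L)
    ((IsScalarTower.toAlgHom R (K ⊗[R] S) L).comp Algebra.TensorProduct.includeRight) s H

/-! ### Perfect closures and p^n-th roots -/

section PerfectClosure

variable (p : ℕ) [Fact p.Prime]

theorem PerfectClosure.mk_pow_prime_pow (A : Type*) [CommRing A] [CharP A p] (n : ℕ) (a : A) :
    PerfectClosure.mk A p (n, a) ^ p ^ n = PerfectClosure.of A p a := by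
  rw [← PerfectClosure.iterate_frobenius_mk, iterate_frobenius]

theorem PerfectClosure.exists_of_eq_pow (A : Type*) [CommRing A] [CharP A p]
    (x : PerfectClosure A p) : ∃ n, ∀ m, n ≤ m → ∃ a, PerfectClosure.of A p a = x ^ p ^ m := by
  obtain ⟨⟨n, a⟩, rfl⟩ := PerfectClosure.mk_surjective A p x
  refine ⟨n, fun m hm ↦ ⟨a ^ p ^ (m - n), ?_⟩⟩
  rw [map_pow, ← mk_pow_prime_pow p A n, ← pow_mul, ← pow_add, Nat.add_sub_cancel' hm]

theorem PerfectClosure.of_injective (A : Type*) [CommRing A] [CharP A p] [IsReduced A] :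
    Function.Injective (PerfectClosure.of A p) := fun x y h ↦ by
  simpa using (PerfectClosure.eq_iff A p (0, x) (0, y)).1 h

/-- Finiteness of the perfect closure, expressed without leaving the original rings. -/
theorem exists_pow_eq_sum_of_perfectClosureMap_finite {R S : Type*} [CommRing R] [CharP R p]
    [CommRing S] [CharP S p] [IsReduced S] [Algebra R S] (h : (perfectClosureMap p R S).Finite) :
    ∃ (k : ℕ) (s : Fin k → S), ∀ (x : S) (n : ℕ), ∃ (m : ℕ) (r : Fin k → R),
      x ^ p ^ m = ∑ i, r i • s i ^ p ^ (m + n) := by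
  algebraize [perfectClosureMap p R S]
  obtain ⟨k, g, hg⟩ := Module.Finite.exists_fin (R := PerfectClosure R p) (M := PerfectClosure S p)
  choose e he using fun i ↦ PerfectClosure.exists_of_eq_pow p S (g i)
  let E := ∑ i, e i
  choose s hs using fun i ↦ he i E
    (Finset.single_le_sum (fun _ _ ↦ Nat.zero_le _) (Finset.mem_univ i))
  refine ⟨k, s, fun x n ↦ ?_⟩
  -- The p^(n+E)-th root of x: E clears the roots in the generators, n supplies the extra exponent
  -- on the s_i. Expanding y in the generators and raising to the power p^(m+n+E) gives the claim.
  let y := PerfectClosure.mk S p (n + E, x)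
  have hy : y ^ p ^ (n + E) = PerfectClosure.of S p x := PerfectClosure.mk_pow_prime_pow p S _ x
  obtain ⟨ρ, hρ⟩ := (Submodule.mem_span_range_iff_exists_fun (PerfectClosure R p)).1
    (hg ▸ Submodule.mem_top : y ∈ Submodule.span (PerfectClosure R p) (Set.range g))
  choose d hd using fun i ↦ PerfectClosure.exists_of_eq_pow p R (ρ i)
  let m := ∑ i, d i
  have hm (i) : d i ≤ m + (n + E) :=
    (Finset.single_le_sum (fun _ _ ↦ Nat.zero_le _) (Finset.mem_univ i)).trans
      (Nat.le_add_right _ _)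
  choose r hr using fun i ↦ hd i _ (hm i)
  refine ⟨m, r, PerfectClosure.of_injective p S ?_⟩
  rw [map_pow, ← hy, ← hρ, ← pow_mul, ← pow_add, sum_pow_char_pow, map_sum]
  refine Finset.sum_congr rfl fun i _ ↦ ?_
  have e₁ : n + E + m = m + (n + E) := by omega
  have e₂ : E + (m + n) = m + (n + E) := by omega
  rw [smul_pow, Algebra.smul_def (r i), map_mul, ← perfectClosureMap_of, map_pow, hs, ← pow_mul,
    ← pow_add, hr, Algebra.smul_def, RingHom.algebraMap_toAlgebra, e₁, e₂]

/-- The isomorphism `A ≃ A ^ (1 / p ^ n)` given by taking `p ^ n`-th roots. -/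
noncomputable def rootRingEquiv (A : Type*) [CommRing A] [CharP A p] [IsReduced A] (n : ℕ) :
    A ≃+* rootRing p A n :=
  RingEquiv.ofBijective (RingHom.codRestrict
    ((iterateFrobeniusEquiv (PerfectClosure A p) p n).symm.toRingHom.comp (PerfectClosure.of A p))
    (rootRing p A n) fun a ↦ mem_rootRing.2 ⟨a, by
      simp [← iterateFrobeniusEquiv_apply, ← iterateFrobenius_def]⟩)
    ⟨fun _ _ h ↦ PerfectClosure.of_injective p A
      ((iterateFrobeniusEquiv (PerfectClosure A p) p n).symm.injective (congrArg Subtype.val h)),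
    fun y ↦ by
      obtain ⟨a, ha⟩ := mem_rootRing.1 y.2
      exact ⟨a, Subtype.ext ((iterateFrobeniusEquiv (PerfectClosure A p) p n).symm_apply_eq.2 ha)⟩⟩

theorem rootRingEquiv_pow (A : Type*) [CommRing A] [CharP A p] [IsReduced A] (n : ℕ) (a : A) :
    (rootRingEquiv p A n a : PerfectClosure A p) ^ p ^ n = PerfectClosure.of A p a :=
  (iterateFrobeniusEquiv (PerfectClosure A p) p n).apply_symm_apply _

theorem rootRingMap_rootRingEquiv (R S : Type*) [CommRing R] [CharP R p] [IsReduced R]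
    [CommRing S] [CharP S p] [IsReduced S] [Algebra R S] (n : ℕ) (r : R) :
    rootRingMap p R S n (rootRingEquiv p R n r) = rootRingEquiv p S n (algebraMap R S r) := by
  refine Subtype.ext ((iterateFrobeniusEquiv (PerfectClosure S p) p n).injective ?_)
  change perfectClosureMap p R S (rootRingEquiv p R n r : PerfectClosure R p) ^ p ^ n =
    (rootRingEquiv p S n (algebraMap R S r) : PerfectClosure S p) ^ p ^ n
  rw [← map_pow, rootRingEquiv_pow, rootRingEquiv_pow, perfectClosureMap_of]

end PerfectClosure

/-! ### Étaleness of R_n → S_n -/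

theorem RingHom.Etale.comp_etale {R S T : Type*} [CommRing R] [CommRing S] [CommRing T]
    {f : R →+* S} {g : S →+* T} (hf : f.Etale) (hg : g.Etale) : (g.comp f).Etale := by
  algebraize [f, g, g.comp f]
  exact Algebra.Etale.comp R S T

theorem corollary6p8 (p : ℕ) [Fact p.Prime]
    (R : Type*) [CommRing R] [IsRegularLocalRing R] [CharP R p]
    (S : Type*) [CommRing S] [IsLocalRing S] [IsReduced S] [CharP S p] [Algebra R S]
    (hgen : GenericallyEtale R S)
    (hne : Nontrivial (FractionRing R ⊗[R] S))
    (hfin : (perfectClosureMap p R S).Finite) :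
    ∃ N : ℕ, ∀ n : ℕ, N ≤ n → (rootRingMap p R S n).Etale := by
  have := IsRegularLocalRing.isDomain R
  obtain ⟨k, s, H⟩ := exists_pow_eq_sum_of_perfectClosureMap_finite p hfin
  have hS : (algebraMap R S).Etale :=
    RingHom.etale_algebraMap.2 (IsRegularLocalRing.etale_of_genericallyEtale p R S hgen hne s H)
  refine ⟨0, fun n _ ↦ ?_⟩
  have : rootRingMap p R S n = ((rootRingEquiv p S n : S →+* rootRing p S n).comp
      (algebraMap R S)).comp ((rootRingEquiv p R n).symm : rootRing p R n →+* R) := by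
    ext x
    obtain ⟨r, rfl⟩ := (rootRingEquiv p R n).surjective x
    rw [rootRingMap_rootRingEquiv]
    simp
  rw [this]
  exact .comp_etale (.of_bijective (rootRingEquiv p R n).symm.bijective)
    (.comp_etale hS (.of_bijective (rootRingEquiv p S n).bijective))
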